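/- **Proposition 4.5.** Let $N,d\ge 1$ be integers, let $\Omega\subset\mathbb R^N$ be open and bounded, and let $W:\Omega\times\mathbb R^{d\times N}\times\mathbb R^{d\times N\times N}\to[0,\infty)$ and $\Psi_2:\Omega\times\mathbb R^{d\times N}\times S^{N-1}\to[0,\infty)$. Assume that there is $C>0$ such that $$|W(x,A_1,M_1)-W(x,A_2,M_2)|\le C\big(|A_1-A_2|+|M_1-M_2|\big)\qquad\text{for all }x\in\Omega,\ A_i\in\mathbb R^{d\times N},\ M_i\in\mathbb R^{d\times N\times N},\ i=1,2 .$$ For $v\in BV(\Omega;\mathbb R^{d\times N})$ let $\nabla v$ be the density of the absolutely continuous part of the measure $Dv$ with respect to Lebesgue measure, $S_v$ the jump set of $v$, and $(v^+,v^-,\nu_v)$ the one-sided approximate limits and the unit normal on $S_v$, oriented so that the first nonzero coordinate of $\nu_v$ is positive; $[v]=v^+-v^-$. The space $SBV(\Omega;\mathbb R^{d\times N})$ consists of those $v\in BV(\Omega;\mathbb R^{d\times N})$ with $Dv=\nabla v\,\mathcal L^N\lfloor\Omega+[v]\otimes\nu_v\,\mathcal H^{N-1}\lfloor S_v$. Let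 $G\in BV(\Omega;\mathbb R^{d\times N})$ and $\Gamma\in L^1(\Omega;\mathbb R^{d\times N\times N})$, and let $\mathcal A(G,\Gamma)$ be the set of sequences $\{v_n\}\subset SBV(\Omega;\mathbb R^{d\times N})$ with $v_n\to G$ in $L^1(\Omega;\mathbb R^{d\times N})$ and $\nabla v_n\overset{*}{\rightharpoonup}\Gamma$ as measures, i.e. $\int_\Omega\varphi\,\nabla v_n\,dx\to\int_\Omega\varphi\,\Gamma\,dx$ for all $\varphi\in C_0(\Omega)$. Define, with values in $[0,\infty]$ and $\inf\emptyset=+\infty$, $$I_2(G,\Gamma):=\inf_{\{v_n\}\in\mathcal A(G,\Gamma)}\ \liminf_{n\to+\infty}\Big[\int_\Omega W(x,v_n(x),\nabla v_n(x))\,dx+\int_{S_{v_n}\cap\Omega}\Psi_2(x,[v_n](x),\nu_{v_n}(x))\,d\mathcal H^{N-1}(x)\Big],$$ $$\tilde I_2(G,\Gamma):=\inf_{\{v_n\}\in\mathcal A(G,\Gamma)}\ \liminf_{n\to+\infty}\Big[\int_\Omega W(x,G(x),\nabla v_n(x))\,dx+\int_{S_{v_n}\cap\Omega}\Psi_2(x,[v_n](x),\nu_{v_n}(x))\,d\mathcal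 H^{N-1}(x)\Big].$$ (Integrals of nonnegative functions are suprema of integrals of measurable simple functions below the integrand.) Then $$I_2(G,\Gamma)=\tilde I_2(G,\Gamma).$$ -/

import Mathlib

open MeasureTheory Filter Topology Set
open scoped ENNReal NNReal ContDiff

noncomputable section

namespace StructuredDeformation

/-- `ℝ^N` with its Euclidean norm. -/
abbrev Pt (N : ℕ) : Type := EuclideanSpace ℝ (Fin N)

/-- `ℝ^{d×N}` with the Euclidean (Frobenius) norm. -/
abbrev Mat (d N : ℕ) : Type := EuclideanSpace ℝ (Fin d × Fin N)

/-- `ℝ^{d×N×N}` with the Euclidean norm; the last index is the direction of differentiation. -/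
abbrev Tens (d N : ℕ) : Type := EuclideanSpace ℝ ((Fin d × Fin N) × Fin N)

variable {N : ℕ} {ι : Type} [Fintype ι]

/-- `φ ∈ C_c^∞(Ω)`. -/
def IsTestFunction (Ω : Set (Pt N)) (φ : Pt N → ℝ) : Prop :=
  ContDiff ℝ ∞ φ ∧ HasCompactSupport φ ∧ tsupport φ ⊆ Ω

/-- The finite signed measures `μ i j` are concentrated on `Ω` and are the distributional
derivatives `D_j u_i` in `Ω`: `∫_Ω u_i ∂_j φ dx = - ∫_Ω φ d(μ i j)` for `φ ∈ C_c^∞(Ω)`. -/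
def IsDistribDeriv (Ω : Set (Pt N)) (u : Pt N → EuclideanSpace ℝ ι)
    (μ : ι → Fin N → SignedMeasure (Pt N)) : Prop :=
  ∀ i j, (∀ B, MeasurableSet B → Disjoint B Ω → μ i j B = 0) ∧
    ∀ φ, IsTestFunction Ω φ →
      ∫ x in Ω, u x i * fderiv ℝ φ x (EuclideanSpace.single j 1) = - ∫ᵛ x, φ x ∂•(μ i j)

/-- `u ∈ BV(Ω; ℝ^ι)`. -/
def IsBV (Ω : Set (Pt N)) (u : Pt N → EuclideanSpace ℝ ι) : Prop :=
  IntegrableOn u Ω volume ∧ ∃ μ, IsDistribDeriv Ω u μ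

open Classical in
/-- The matrix-valued measure `Du` (the family `IsDistribDeriv` determines is unique), with the
value `0` if `u` has no distributional derivative that is a finite measure. -/
def distribDeriv (Ω : Set (Pt N)) (u : Pt N → EuclideanSpace ℝ ι) :
    ι → Fin N → SignedMeasure (Pt N) :=
  if h : ∃ μ, IsDistribDeriv Ω u μ then h.choose else 0

/-- `∇u`: the density, with respect to Lebesgue measure, of the absolutely continuous part
of `Du`. -/
def grad (Ω : Set (Pt N)) (u : Pt N → EuclideanSpace ℝ ι) (x : Pt N) :
    EuclideanSpace ℝ (ι × Fin N) :=
  WithLp.toLp 2 fun p => (distribDeriv Ω u p.1 p.2).rnDeriv volume x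

/-- The approximate limit of `u` at `x` exists. Averages over balls are used; since balls and
cubes centred at `x` contain one another up to a fixed dilation, cubes give the same notion. -/
def HasApproxLimit (u : Pt N → EuclideanSpace ℝ ι) (x : Pt N) : Prop :=
  ∃ z, Tendsto (fun ε : ℝ => (∫⁻ y in Metric.ball x ε, ‖u y - z‖ₑ) / ENNReal.ofReal (ε ^ N))
    (𝓝[>] 0) (𝓝 0)

/-- `ν` is a unit vector, `a ≠ b`, and `a`, `b` are the one-sided approximate limits of `u` at `x`
on the sides `(y - x) · ν > 0` and `(y - x) · ν < 0`. -/
def IsJumpTriple (u : Pt N → EuclideanSpace ℝ ι) (x : Pt N) (a b : EuclideanSpace ℝ ι)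
    (ν : Pt N) : Prop :=
  ‖ν‖ = 1 ∧ a ≠ b ∧
  Tendsto (fun ε : ℝ => (∫⁻ y in Metric.ball x ε ∩ {y | 0 < inner ℝ (y - x) ν}, ‖u y - a‖ₑ) /
    ENNReal.ofReal (ε ^ N)) (𝓝[>] 0) (𝓝 0) ∧
  Tendsto (fun ε : ℝ => (∫⁻ y in Metric.ball x ε ∩ {y | inner ℝ (y - x) ν < 0}, ‖u y - b‖ₑ) /
    ENNReal.ofReal (ε ^ N)) (𝓝[>] 0) (𝓝 0)

/-- The jump set `S_u`. -/
def jumpSet (Ω : Set (Pt N)) (u : Pt N → EuclideanSpace ℝ ι) : Set (Pt N) :=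
  {x | x ∈ Ω ∧ ¬ HasApproxLimit u x ∧ ∃ a b ν, IsJumpTriple u x a b ν}

/-- The first nonzero coordinate of `ν` is positive. Of `ν` and `-ν`, `ν ≠ 0`, exactly one
has this property. -/
def IsOriented (ν : Pt N) : Prop :=
  ∃ k, 0 < ν k ∧ ∀ l < k, ν l = 0

open Classical in
/-- The triple `(u⁺(x), u⁻(x), ν_u(x))` for `x ∈ S_u`. It is unique up to replacing `(a, b, ν)` by
`(b, a, -ν)`, and becomes unique by the choice of orientation `IsOriented`. -/
def jumpTriple (u : Pt N → EuclideanSpace ℝ ι) (x : Pt N) :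
    EuclideanSpace ℝ ι × EuclideanSpace ℝ ι × Pt N :=
  if h : ∃ p : EuclideanSpace ℝ ι × EuclideanSpace ℝ ι × Pt N,
    IsJumpTriple u x p.1 p.2.1 p.2.2 ∧ IsOriented p.2.2 then h.choose else 0

/-- `[u](x) = u⁺(x) - u⁻(x)`. -/
def jump (u : Pt N → EuclideanSpace ℝ ι) (x : Pt N) : EuclideanSpace ℝ ι :=
  (jumpTriple u x).1 - (jumpTriple u x).2.1

/-- `ν_u(x)`. -/
def jumpNormal (u : Pt N → EuclideanSpace ℝ ι) (x : Pt N) : Pt N :=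
  (jumpTriple u x).2.2

/-- `u ∈ SBV(Ω; ℝ^ι)`: `u ∈ BV(Ω; ℝ^ι)` and `Du = ∇u 𝓛^N⌊Ω + [u] ⊗ ν_u 𝓗^{N-1}⌊S_u`.
Here `μHE[N - 1]` is the Hausdorff measure normalized as usual (to agree with surface area). -/
def IsSBV (Ω : Set (Pt N)) (u : Pt N → EuclideanSpace ℝ ι) : Prop :=
  IsBV Ω u ∧ ∀ i j,
    IntegrableOn (fun x => jump u x i * jumpNormal u x j) (jumpSet Ω u) μHE[N - 1] ∧
    ∀ B, MeasurableSet B → distribDeriv Ω u i j B =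
      (∫ x in B ∩ Ω, grad Ω u x (i, j)) +
        ∫ x in B ∩ jumpSet Ω u, jump u x i * jumpNormal u x j ∂μHE[N - 1]

/-- `f_n ⇀* f` as measures in `𝓜(Ω) = C_0(Ω)'`, for integrable `f_n`, `f` and bounded open `Ω`:
the test functions are the continuous functions on `ℝ^N` that vanish outside `Ω`. -/
def WeakStarTendsto (Ω : Set (Pt N)) (f : ℕ → Pt N → EuclideanSpace ℝ ι)
    (f₀ : Pt N → EuclideanSpace ℝ ι) : Prop :=
  ∀ φ : Pt N → ℝ, Continuous φ → (∀ x, x ∉ Ω → φ x = 0) → ∀ i,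
    Tendsto (fun n => ∫ x in Ω, φ x * f n x i) atTop (𝓝 (∫ x in Ω, φ x * f₀ x i))

variable {d : ℕ}

/-- `v_n ∈ SBV(Ω; ℝ^{d×N})`, `v_n → G` in `L¹`, and `∇v_n ⇀* Γ`. -/
def IsAdmissible (Ω : Set (Pt N)) (G : Pt N → Mat d N) (Γ : Pt N → Tens d N)
    (v : ℕ → Pt N → Mat d N) : Prop :=
  (∀ n, IsSBV Ω (v n)) ∧
  Tendsto (fun n => eLpNorm (v n - G) 1 (volume.restrict Ω)) atTop (𝓝 0) ∧
  WeakStarTendsto Ω (fun n => grad Ω (v n)) Γ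

/-- `∫_Ω W(x, w, ∇v) dx + ∫_{S_v ∩ Ω} Ψ(x, [v], ν_v) d𝓗^{N-1} ∈ [0, ∞]`. -/
def energy (Ω : Set (Pt N)) (W : Pt N → Mat d N → Tens d N → ℝ≥0)
    (Ψ : Pt N → Mat d N → Pt N → ℝ≥0) (w v : Pt N → Mat d N) : ℝ≥0∞ :=
  (∫⁻ x in Ω, (W x (w x) (grad Ω v x) : ℝ≥0∞)) +
    ∫⁻ x in jumpSet Ω v, (Ψ x (jump v x) (jumpNormal v x) : ℝ≥0∞) ∂μHE[N - 1]

/-- `I₂(G, Γ)`. -/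
def I₂ (Ω : Set (Pt N)) (W : Pt N → Mat d N → Tens d N → ℝ≥0)
    (Ψ : Pt N → Mat d N → Pt N → ℝ≥0) (G : Pt N → Mat d N) (Γ : Pt N → Tens d N) : ℝ≥0∞ :=
  ⨅ (v : ℕ → Pt N → Mat d N) (_ : IsAdmissible Ω G Γ v),
    liminf (fun n => energy Ω W Ψ (v n) (v n)) atTop

/-- `Ĩ₂(G, Γ)`: the second argument of `W` is frozen at `G`. -/
def I₂Frozen (Ω : Set (Pt N)) (W : Pt N → Mat d N → Tens d N → ℝ≥0)
    (Ψ : Pt N → Mat d N → Pt N → ℝ≥0) (G : Pt N → Mat d N) (Γ : Pt N → Tens d N) : ℝ≥0∞ :=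
  ⨅ (v : ℕ → Pt N → Mat d N) (_ : IsAdmissible Ω G Γ v),
    liminf (fun n => energy Ω W Ψ G (v n)) atTop

end StructuredDeformation

end

/-!
Both infima run over the same admissible sequences, so it suffices to compare the two energies
along one such sequence `v`. By the Lipschitz bound on `W`, changing the frozen second argument
from `w₁` to `w₂` changes the bulk energy by at most `C ‖w₁ - w₂‖_{L¹(Ω)}`
(`energy_le_energy_add`), while the interfacial energy and the gradient are untouched. With
`w₁`, `w₂` equal to `v n` and `G`, in either order, the error tends to `0` and disappears in the
lower limit (`liminf_le_liminf_of_le_add`). The function `W` need not be measurable: additivity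
of the lower integral only needs the error term `C ‖w₁ - w₂‖` to be measurable.
-/

namespace StructuredDeformation

/-- A perturbation that tends to `0` does not affect the lower limit. -/
lemma liminf_le_liminf_of_le_add {a b e : ℕ → ℝ≥0∞} (h : ∀ n, a n ≤ b n + e n)
    (he : Tendsto e atTop (𝓝 0)) : liminf a atTop ≤ liminf b atTop := by
  refine ENNReal.le_of_forall_pos_le_add fun δ hδ _ => ?_
  have hev : ∀ᶠ n in atTop, a n ≤ b n + δ := by
    filter_upwards [he.eventually_le_const (ENNReal.coe_pos.2 hδ)] with n hn
    exact (h n).trans (by gcongr)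
  calc liminf a atTop ≤ liminf (fun n => b n + δ) atTop := liminf_le_liminf hev
    _ = liminf b atTop + δ := liminf_add_const atTop b δ (by isBoundedDefault) (by isBoundedDefault)

/-- The energy is Lipschitz, in the `L¹(Ω)` norm, in the function that is substituted for the
second argument of `W`. -/
lemma energy_le_energy_add {N d : ℕ} {Ω : Set (Pt N)} (hΩ : MeasurableSet Ω)
    {W : Pt N → Mat d N → Tens d N → ℝ≥0} (Ψ : Pt N → Mat d N → Pt N → ℝ≥0) {C : ℝ≥0}
    (hW : ∀ x ∈ Ω, ∀ (A₁ A₂ : Mat d N) (M : Tens d N),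
      (W x A₁ M : ℝ≥0∞) ≤ W x A₂ M + C * ‖A₁ - A₂‖ₑ)
    {w₁ w₂ : Pt N → Mat d N} (h₁ : AEStronglyMeasurable w₁ (volume.restrict Ω))
    (h₂ : AEStronglyMeasurable w₂ (volume.restrict Ω)) (v : Pt N → Mat d N) :
    energy Ω W Ψ w₁ v ≤ energy Ω W Ψ w₂ v + C * eLpNorm (w₁ - w₂) 1 (volume.restrict Ω) := by
  have hbulk : ∫⁻ x in Ω, (W x (w₁ x) (grad Ω v x) : ℝ≥0∞) ≤
      (∫⁻ x in Ω, (W x (w₂ x) (grad Ω v x) : ℝ≥0∞)) +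
        C * eLpNorm (w₁ - w₂) 1 (volume.restrict Ω) := by
    rw [eLpNorm_one_eq_lintegral_enorm, ← lintegral_const_mul' _ _ ENNReal.coe_ne_top,
      ← lintegral_add_right' _ ((h₁.sub h₂).enorm.const_mul _)]
    exact setLIntegral_mono' hΩ fun x hx => hW x hx _ _ _
  unfold energy
  rw [add_right_comm]
  gcongr

end StructuredDeformation

open StructuredDeformation in
theorem proposition4p5 {N d : ℕ} (hN : 1 ≤ N) (Ω : Set (Pt N)) (hΩ : IsOpen Ω)
    (hΩb : Bornology.IsBounded Ω)
    (W : Pt N → Mat d N → Tens d N → ℝ≥0) (Ψ : Pt N → Mat d N → Pt N → ℝ≥0)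
    (hW : ∃ C : ℝ, 0 < C ∧ ∀ x ∈ Ω, ∀ (A₁ A₂ : Mat d N) (M₁ M₂ : Tens d N),
      |(W x A₁ M₁ : ℝ) - W x A₂ M₂| ≤ C * (‖A₁ - A₂‖ + ‖M₁ - M₂‖))
    (G : Pt N → Mat d N) (hG : IsBV Ω G)
    (Γ : Pt N → Tens d N) (hΓ : IntegrableOn Γ Ω volume) :
    I₂ Ω W Ψ G Γ = I₂Frozen Ω W Ψ G Γ := by
  obtain ⟨C, hC, hW⟩ := hW
  lift C to ℝ≥0 using hC.le
  have hLip : ∀ x ∈ Ω, ∀ (A₁ A₂ : Mat d N) (M : Tens d N),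
      (W x A₁ M : ℝ≥0∞) ≤ W x A₂ M + C * ‖A₁ - A₂‖ₑ := by
    intro x hx A₁ A₂ M
    have h := (abs_le.1 (hW x hx A₁ A₂ M M)).2
    rw [sub_self, norm_zero, add_zero, sub_le_iff_le_add'] at h
    rw [enorm_eq_nnnorm]
    exact_mod_cast h
  unfold I₂ I₂Frozen
  refine iInf_congr fun v => iInf_congr fun hv => ?_
  have hGm : AEStronglyMeasurable G (volume.restrict Ω) := hG.1.aestronglyMeasurable
  have hvm : ∀ n, AEStronglyMeasurable (v n) (volume.restrict Ω) :=
    fun n => (hv.1 n).1.1.aestronglyMeasurable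
  have herr : Tendsto (fun n => (C : ℝ≥0∞) * eLpNorm (v n - G) 1 (volume.restrict Ω))
      atTop (𝓝 0) := by
    simpa using ENNReal.Tendsto.const_mul hv.2.1 (Or.inr ENNReal.coe_ne_top)
  apply le_antisymm
  · exact liminf_le_liminf_of_le_add
      (fun n => energy_le_energy_add hΩ.measurableSet Ψ hLip (hvm n) hGm (v n)) herr
  · refine liminf_le_liminf_of_le_add (fun n => ?_) herr
    rw [eLpNorm_sub_comm]
    exact energy_le_energy_add hΩ.measurableSet Ψ hLip hGm (hvm n) (v n)
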